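/- Let $T$ be a set, whose elements are called types. An oriented multi-virtual link diagram of type $T$ is a planar drawing of an oriented link with finitely many transverse double points, each of which is either a classical crossing (with over/under information) or a virtual crossing labelled by a type from $T$. Two such diagrams are called equivalent if one is obtained from the other by finitely many applications of planar isotopy, classical Reidemeister moves (with arbitrary orientations) and multi-virtual detour moves. A multi-virtual detour move takes a strand that meets the $m$ lower ends of an $m,n$-tangle in virtual crossings, all of the same type $\alpha$, and moves it across the tangle, so that it meets the $n$ upper ends of the tangle in virtual crossings of type $\alpha$; loops whose only crossing is virtual of type $\alpha$ may be added to or removed from the strand. Fix a sign $\varepsilon\in\{+,-\}$ and a side (left or right), and consider the following moves, each of which may be used in both directions. * $\Omega1a$, $\Omega1b$: removal of a clockwise, respectively counterclockwise, loop whose only crossing is classical of sign $\varepsilon$; the loop lies to the right, respectively to the left, of the oriented strand. * $\Omega2a$: removal of a bigon between two strands running in the same direction, where the strand on the chosen side passes over the other one at both (classical) crossings. * $\Omega3a$: the classical Reidemeister 3 move on a triangle whose three sides are coherently oriented, where the crossing of the top and bottom strands has sign $-\varepsilon$ and the two crossings with the middle strand have sign $\varepsilon$. * $v1a$, $v1b$: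 as $\Omega1a$, $\Omega1b$, with a virtual crossing of any type $\alpha\in T$. * $v2a$: as $\Omega2a$, with two virtual crossings of the same type $\alpha\in T$. * $cv3a$: a strand crossing two other strands in virtual crossings of the same type $\alpha\in T$ is moved across the classical crossing of these two strands, which is negative; the three sides of the triangle are coherently oriented. * $mv3a$: as $cv3a$, with a virtual crossing of any type $\beta\in T$ (possibly $\beta=\alpha$) in place of the classical crossing. Theorem. For each choice of $\varepsilon$ and of the side, two oriented multi-virtual link diagrams of type $T$ are equivalent if and only if one is obtained from the other by finitely many applications of planar isotopy and the moves $\Omega1a$, $\Omega1b$, $\Omega2a$, $\Omega3a$, $v1a$, $v1b$, $v2a$, $cv3a$ and $mv3a$. -/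

import Mathlib

/-!
Oriented multi-virtual link diagrams, in the style of sliced diagrams.

A planar drawing in general position with respect to the height function is cut by horizontal
lines into strips, each containing exactly one local minimum, one local maximum or one crossing,
next to vertical strands.  Reading the strips from bottom to top gives a word.  Everything below
is planar: the words remember the drawing, not only its Gauss code.
-/

namespace MultiVirtual

/-- The vertical direction in which an oriented strand runs through a horizontal level. -/
inductive Dir
  | up
  | down

/-- The opposite direction. -/
def Dir.rev : Dir → Dir
  | up => down
  | down => up

/-- The overpass of a classical crossing: the strand drawn like `/` (joining bottom left to top
right), or the strand drawn like `\` (joining bottom right to top left). -/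
inductive Over
  | slash
  | backslash

/-- The other strand is the overpass. -/
def Over.flip : Over → Over
  | slash => backslash
  | backslash => slash

/-- A crossing is classical, or virtual of some type from `T`. -/
inductive Crossing (T : Type*)
  | classical (o : Over)
  | virtual (α : T)

/-- The same crossing after a quarter turn, which exchanges the strands drawn `/` and `\`. -/
def Crossing.turn {T : Type*} : Crossing T → Crossing T
  | classical o => classical o.flip
  | virtual α => virtual α

/-- The pieces of a drawing: a local minimum `∪` whose left and right ends have directions
`d` and `d.rev`; a local maximum `∩`, likewise; a crossing whose lower left strand has
direction `a` and whose lower right strand has direction `b`. -/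
inductive Piece (T : Type*)
  | cup (d : Dir)
  | cap (d : Dir)
  | cross (x : Crossing T) (a b : Dir)

/-- The directions at the lower ends of a piece, from left to right. -/
def Piece.bottom {T : Type*} : Piece T → List Dir
  | cup _ => []
  | cap d => [d, d.rev]
  | cross _ a b => [a, b]

/-- The directions at the upper ends of a piece, from left to right. -/
def Piece.top {T : Type*} : Piece T → List Dir
  | cup d => [d, d.rev]
  | cap _ => []
  | cross _ a b => [b, a]

/-- A strip containing one piece, with `offset` vertical strands to the left of it. -/
structure Slice (T : Type*) where
  offset : ℕ
  piece : Piece T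

/-- A sequence of strips, listed from bottom to top. -/
abbrev Word (T : Type*) := List (Slice T)

/-- The word `w` with `n` further vertical strands drawn on its left. -/
def shift {T : Type*} (n : ℕ) (w : Word T) : Word T :=
  w.map fun σ => ⟨n + σ.offset, σ.piece⟩

/-- `IsTangle s w t`: the strips of `w` fit together to an oriented tangle diagram whose lower
boundary reads `s` and whose upper boundary reads `t`. -/
inductive IsTangle {T : Type*} : List Dir → Word T → List Dir → Prop
  | nil (s : List Dir) : IsTangle s [] s
  | cons (l r : List Dir) (p : Piece T) (w : Word T) (t : List Dir) :
      IsTangle (l ++ p.top ++ r) w t → IsTangle (l ++ p.bottom ++ r) (⟨l.length, p⟩ :: w) t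

/-- An oriented multi-virtual link diagram of type `T`: a tangle diagram without endpoints. -/
structure Diagram (T : Type*) where
  word : Word T
  isTangle : IsTangle [] word []

/-- A family of local moves: `M s t u v` says that the tangle diagram `u` may be replaced by the
tangle diagram `v`, both having lower boundary `s` and upper boundary `t`. -/
abbrev Moves (T : Type*) := List Dir → List Dir → Word T → Word T → Prop

/-- `D'` arises from `D` by applying one of the local moves inside a box, the rest of the
drawing being unchanged. -/
def Step {T : Type*} (M : Moves T) (D D' : Diagram T) : Prop :=
  ∃ (l r s t : List Dir) (u v below above : Word T),
    M s t u v ∧ IsTangle s u t ∧ IsTangle s v t ∧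
    IsTangle [] below (l ++ s ++ r) ∧ IsTangle (l ++ t ++ r) above [] ∧
    D.word = below ++ shift l.length u ++ above ∧
    D'.word = below ++ shift l.length v ++ above

/-- `D'` is obtained from `D` by finitely many applications of the local moves, each of which may
be used in either direction. -/
def Related {T : Type*} (M : Moves T) : Diagram T → Diagram T → Prop :=
  Relation.EqvGen (Step M)

/-- Planar isotopy.  A generic isotopy of the plane changes the sequence of strips only when
two pieces that lie apart exchange their heights, when a local maximum and a local minimum on the
same strand cancel or appear, or when a strand becomes horizontal at a crossing, so that
a local maximum or minimum passes through this crossing. -/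
inductive Isotopy {T : Type*} : Moves T
  | exchange (p q : Piece T) (m : List Dir) :
      Isotopy (p.bottom ++ m ++ q.bottom) (p.top ++ m ++ q.top)
        [⟨0, p⟩, ⟨p.top.length + m.length, q⟩]
        [⟨p.bottom.length + m.length, q⟩, ⟨0, p⟩]
  | zigzagRight (d : Dir) :
      Isotopy [d] [d] [⟨1, .cup d.rev⟩, ⟨0, .cap d⟩] []
  | zigzagLeft (d : Dir) :
      Isotopy [d] [d] [⟨0, .cup d⟩, ⟨1, .cap d.rev⟩] []
  | capSlide (x : Crossing T) (a b : Dir) :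
      Isotopy [b, a, b.rev] [a]
        [⟨0, .cross x b a⟩, ⟨1, .cap b⟩]
        [⟨1, .cross x.turn a b.rev⟩, ⟨0, .cap b⟩]
  | cupSlide (x : Crossing T) (a b : Dir) :
      Isotopy [a] [b, a, b.rev]
        [⟨1, .cup b⟩, ⟨0, .cross x a b⟩]
        [⟨0, .cup b⟩, ⟨1, .cross x.turn b.rev a⟩]

/-- A strand of direction `d` with a loop on its right (clockwise if `d` is upward). -/
def loopRight {T : Type*} (x : Crossing T) (d : Dir) : Word T :=
  [⟨1, .cup d⟩, ⟨0, .cross x d d⟩, ⟨1, .cap d⟩]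

/-- A strand of direction `d` with a loop on its left (counterclockwise if `d` is upward). -/
def loopLeft {T : Type*} (x : Crossing T) (d : Dir) : Word T :=
  [⟨0, .cup d.rev⟩, ⟨1, .cross x d d⟩, ⟨0, .cap d.rev⟩]

/-- Two strands of directions `a` (left) and `b` (right) forming a bigon.  The two crossings have
the same kind: either they are classical with the same strand over the other one in both, or they
are virtual of the same type. -/
def bigon {T : Type*} (x : Crossing T) (a b : Dir) : Word T :=
  [⟨0, .cross x a b⟩, ⟨0, .cross x.turn b a⟩]

/-- Three strands whose directions are, at the bottom and from left to right, `a`, `b`, `c`.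
The crossings of the first and second, first and third, second and third strands
are `x`, `y`, `z`; the middle strand passes to the left of the crossing `y`. -/
def triangleLeft {T : Type*} (x y z : Crossing T) (a b c : Dir) : Word T :=
  [⟨0, .cross x a b⟩, ⟨1, .cross y a c⟩, ⟨0, .cross z b c⟩]

/-- As in `triangleLeft`, but the middle strand passes to the right of the crossing `y`. -/
def triangleRight {T : Type*} (x y z : Crossing T) (a b c : Dir) : Word T :=
  [⟨1, .cross z b c⟩, ⟨0, .cross y a c⟩, ⟨1, .cross x a b⟩]

/-- The classical Reidemeister moves with all possible orientations.  In `three`, the condition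
says that one of the three strands lies over the two others, and one under the two others. -/
inductive Reidemeister {T : Type*} : Moves T
  | oneRight (o : Over) (d : Dir) : Reidemeister [d] [d] (loopRight (.classical o) d) []
  | oneLeft (o : Over) (d : Dir) : Reidemeister [d] [d] (loopLeft (.classical o) d) []
  | two (o : Over) (a b : Dir) : Reidemeister [a, b] [a, b] (bigon (.classical o) a b) []
  | three (o₁ o₂ o₃ : Over) (a b c : Dir) (h : o₁ = o₃ → o₂ = o₁) :
      Reidemeister [a, b, c] [c, b, a]
        (triangleLeft (.classical o₁) (.classical o₂) (.classical o₃) a b c)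
        (triangleRight (.classical o₁) (.classical o₂) (.classical o₃) a b c)

/-- A strand of direction `d` running from the lower left to the upper right across the vertical
strands `s`, all crossings being virtual of type `α`. -/
def pass {T : Type*} (α : T) (d : Dir) : List Dir → Word T
  | [] => []
  | e :: s => ⟨0, .cross (.virtual α) d e⟩ :: shift 1 (pass α d s)

/-- The multi-virtual detour moves.  A strand which meets the strands of an arbitrary tangle diagram
`w` only in virtual crossings of type `α` is moved across `w`, from the lower ends `s` to
the upper ends `t` of `w`, all new crossings being virtual of type `α`; and loops of
type `α` are freely added to the strand or removed from it. -/
inductive Detour {T : Type*} : Moves T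
  | slide (α : T) (d : Dir) (s t : List Dir) (w : Word T) (h : IsTangle s w t) :
      Detour (d :: s) (t ++ [d]) (pass α d s ++ w) (shift 1 w ++ pass α d t)
  | loopRight (α : T) (d : Dir) : Detour [d] [d] (loopRight (.virtual α) d) []
  | loopLeft (α : T) (d : Dir) : Detour [d] [d] (loopLeft (.virtual α) d) []

/-- Equivalence of oriented multi-virtual link diagrams: isotopy, classical Reidemeister moves and
multi-virtual detour moves. -/
def Equivalent {T : Type*} : Diagram T → Diagram T → Prop :=
  Related fun s t u v => Isotopy s t u v ∨ Reidemeister s t u v ∨ Detour s t u v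

/-- The nine oriented moves.  In `Ω1a` and `Ω1b` the loops are clockwise and counterclockwise, and
their crossings have the same sign: positive if `o₁ = .slash`, negative if `o₁ = .backslash`.  In
`Ω2a` and `v2a` both strands run in the same direction; `o₂` tells which strand is over in `Ω2a`.
In `Ω3a`, `cv3a` and `mv3a` the sides of the triangle are coherently oriented.  In `Ω3a` the middle
strand is neither the top nor the bottom one, and the crossing of the top and bottom
strands has the sign opposite to that of `Ω1a` and `Ω1b`.  In `cv3a` and `mv3a` the middle strand
has two virtual crossings of type `α`; the remaining crossing is a negative classical one in `cv3a`,
and virtual of an arbitrary type `β` in `mv3a`. -/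
inductive OrientedMove {T : Type*} (o₁ o₂ : Over) : Moves T
  | Ω1a : OrientedMove o₁ o₂ [.up] [.up] (loopRight (.classical o₁) .up) []
  | Ω1b : OrientedMove o₁ o₂ [.up] [.up] (loopLeft (.classical o₁) .up) []
  | Ω2a : OrientedMove o₁ o₂ [.up, .up] [.up, .up] (bigon (.classical o₂) .up .up) []
  | Ω3a : OrientedMove o₁ o₂ [.up, .down, .up] [.up, .down, .up]
      (triangleLeft (.classical o₁.flip) (.classical o₁.flip) (.classical o₁.flip) .up .down .up)
      (triangleRight (.classical o₁.flip) (.classical o₁.flip) (.classical o₁.flip) .up .down .up)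
  | v1a (α : T) : OrientedMove o₁ o₂ [.up] [.up] (loopRight (.virtual α) .up) []
  | v1b (α : T) : OrientedMove o₁ o₂ [.up] [.up] (loopLeft (.virtual α) .up) []
  | v2a (α : T) : OrientedMove o₁ o₂ [.up, .up] [.up, .up] (bigon (.virtual α) .up .up) []
  | cv3a (α : T) : OrientedMove o₁ o₂ [.up, .down, .up] [.up, .down, .up]
      (triangleLeft (.virtual α) (.classical .backslash) (.virtual α) .up .down .up)
      (triangleRight (.virtual α) (.classical .backslash) (.virtual α) .up .down .up)
  | mv3a (α β : T) : OrientedMove o₁ o₂ [.up, .down, .up] [.up, .down, .up]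
      (triangleLeft (.virtual α) (.virtual β) (.virtual α) .up .down .up)
      (triangleRight (.virtual α) (.virtual β) (.virtual α) .up .down .up)

end MultiVirtual

namespace MultiVirtual

variable {T : Type*}

/-! Both directions reduce to deriving each move of one family from the other inside a box. Local
equivalence `Conv` of tangle diagrams is a congruence, so derivations are chains of rewritings of
short words.

From the nine moves to all moves, the core is `generate`, applied to a classical crossing `x` and to
a virtual one. Putting a loop on a strand and pushing the second strand across the crossing of the
loop (`LoopRight.bigon`, `LoopLeft.bigon`) turns the given parallel bigon into antiparallel ones.
These yield the loops of the opposite sign and, by exchanging two sides of the coherent triangle,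
braid-like triangles; the loop argument then gives every parallel bigon. Once all bigons are
available, rotations and exchanges of strands carry a braid-like triangle to all orientations
(`triangle_of_up`), which settles the third Reidemeister moves, both classical
(`triangle_classical`) and mixed or virtual (`triangle_virtual`). A detour is then performed piece
by piece (`Conv.slide`): a minimum or maximum costs a bigon, a crossing costs a triangle.

Conversely, a detour across a minimum gives the virtual bigons (`bigon_of_slide`), and a detour
across one crossing gives the triangles of `cv3a` and `mv3a` after an exchange of strands. -/

theorem Dir.rev_rev (d : Dir) : d.rev.rev = d := by cases d <;> rfl

theorem Crossing.turn_turn (x : Crossing T) : x.turn.turn = x := by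
  rcases x with (_ | _) | _ <;> rfl

theorem shift_append (n : ℕ) (u v : Word T) : shift n (u ++ v) = shift n u ++ shift n v := by
  simp [shift]

theorem shift_shift (m n : ℕ) (u : Word T) : shift m (shift n u) = shift (m + n) u := by
  simp [shift, Nat.add_assoc]

theorem shift_nil (n : ℕ) : shift n ([] : Word T) = [] := rfl

theorem shift_cons (n m : ℕ) (p : Piece T) (w : Word T) :
    shift n (⟨m, p⟩ :: w) = ⟨n + m, p⟩ :: shift n w := rfl

theorem shift_zero (u : Word T) : shift 0 u = u := by
  simp [shift]

/-! ### Typing of words -/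

theorem IsTangle.append {s t m : List Dir} {u v : Word T} (hu : IsTangle s u m)
    (hv : IsTangle m v t) : IsTangle s (u ++ v) t := by
  induction hu with
  | nil => exact hv
  | cons l r p w t _ ih => exact .cons l r p _ _ (ih hv)

theorem IsTangle.of_append {s t : List Dir} {u v : Word T} (h : IsTangle s (u ++ v) t) :
    ∃ m, IsTangle s u m ∧ IsTangle m v t := by
  induction u generalizing s with
  | nil => exact ⟨s, .nil s, h⟩
  | cons σ u ih =>
    cases h with
    | cons l r p _ _ h =>
      obtain ⟨m, h₁, h₂⟩ := ih h
      exact ⟨m, .cons l r p _ _ h₁, h₂⟩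

theorem IsTangle.context {s t : List Dir} {w : Word T} (h : IsTangle s w t) (l r : List Dir) :
    IsTangle (l ++ s ++ r) (shift l.length w) (l ++ t ++ r) := by
  induction h with
  | nil => exact .nil _
  | cons l' r' p w t _ ih =>
    have := IsTangle.cons (l ++ l') (r' ++ r) p (shift l.length w) (l ++ t ++ r)
      (by simpa using ih)
    simpa [shift] using this

theorem isTangle_cons_iff {s t : List Dir} {n : ℕ} {p : Piece T} {w : Word T} :
    IsTangle s (⟨n, p⟩ :: w) t ↔
      ∃ l r, n = l.length ∧ s = l ++ p.bottom ++ r ∧ IsTangle (l ++ p.top ++ r) w t := by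
  constructor
  · intro h
    cases h with
    | cons l r _ _ _ h => exact ⟨l, r, rfl, rfl, h⟩
  · rintro ⟨l, r, rfl, rfl, h⟩
    exact .cons l r p w t h

/-- Equality of directions, as a Boolean. -/
def Dir.eqb : Dir → Dir → Bool
  | up, up => true
  | down, down => true
  | _, _ => false

theorem Dir.eqb_iff {a b : Dir} : a.eqb b = true ↔ a = b := by
  cases a <;> cases b <;> simp [Dir.eqb]

/-- Replace the initial segment `b` of a list by `t`. -/
def replacePrefix (t : List Dir) : List Dir → List Dir → Option (List Dir)
  | [], s => some (t ++ s)
  | _ :: _, [] => none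
  | a :: b, c :: s => bif a.eqb c then replacePrefix t b s else none

/-- Replace the segment `b` at position `n` of a list by `t`. -/
def replaceAt (b t : List Dir) : ℕ → List Dir → Option (List Dir)
  | 0, s => replacePrefix t b s
  | _ + 1, [] => none
  | n + 1, a :: s => (replaceAt b t n s).map (a :: ·)

/-- The upper boundary of a word with lower boundary `s`, if its strips fit together. -/
def run : List Dir → Word T → Option (List Dir)
  | s, [] => some s
  | s, σ :: w => (replaceAt σ.piece.bottom σ.piece.top σ.offset s).bind (run · w)

theorem replacePrefix_eq_some {t b s m : List Dir} (h : replacePrefix t b s = some m) :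
    ∃ r, s = b ++ r ∧ m = t ++ r := by
  induction b generalizing s with
  | nil =>
    simp only [replacePrefix, Option.some.injEq] at h
    exact ⟨s, rfl, h.symm⟩
  | cons a b ih =>
    cases s with
    | nil => simp [replacePrefix] at h
    | cons c s =>
      cases hac : a.eqb c with
      | false => simp [replacePrefix, hac] at h
      | true =>
        obtain ⟨r, rfl, rfl⟩ := ih (by simpa [replacePrefix, hac] using h)
        exact ⟨r, by rw [Dir.eqb_iff.1 hac]; rfl, rfl⟩

theorem replaceAt_eq_some {b t s m : List Dir} {n : ℕ} (h : replaceAt b t n s = some m) :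
    ∃ l r, l.length = n ∧ s = l ++ b ++ r ∧ m = l ++ t ++ r := by
  induction n generalizing s m with
  | zero =>
    obtain ⟨r, rfl, rfl⟩ := replacePrefix_eq_some h
    exact ⟨[], r, rfl, rfl, rfl⟩
  | succ n ih =>
    cases s with
    | nil => simp [replaceAt] at h
    | cons a s =>
      simp only [replaceAt, Option.map_eq_some_iff] at h
      obtain ⟨m', h, rfl⟩ := h
      obtain ⟨l, r, rfl, rfl, rfl⟩ := ih h
      exact ⟨a :: l, r, rfl, rfl, rfl⟩

/-- Typing becomes evaluation: for concrete words the hypothesis holds by `rfl`. -/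
theorem IsTangle.of_run {s t : List Dir} {w : Word T} (h : run s w = some t) :
    IsTangle s w t := by
  induction w generalizing s with
  | nil =>
    simp only [run, Option.some.injEq] at h
    exact h ▸ .nil s
  | cons σ w ih =>
    obtain ⟨n, p⟩ := σ
    simp only [run, Option.bind_eq_some_iff] at h
    obtain ⟨m, h₁, h₂⟩ := h
    obtain ⟨l, r, rfl, rfl, rfl⟩ := replaceAt_eq_some h₁
    exact .cons l r p w t (ih h₂)

/-! ### Local equivalence -/

/-- Application of one of the moves `M` inside a tangle diagram. -/
def LocalStep (M : Moves T) (S U : List Dir) (w w' : Word T) : Prop :=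
  ∃ (l r s t : List Dir) (u v below above : Word T),
    M s t u v ∧ IsTangle s u t ∧ IsTangle s v t ∧
    IsTangle S below (l ++ s ++ r) ∧ IsTangle (l ++ t ++ r) above U ∧
    w = below ++ shift l.length u ++ above ∧ w' = below ++ shift l.length v ++ above

/-- Equivalence of tangle diagrams with lower boundary `s` and upper boundary `t` under the
moves `M`. -/
def Conv (M : Moves T) (s t : List Dir) : Word T → Word T → Prop :=
  Relation.EqvGen (LocalStep M s t)

variable {M N : Moves T} {s t s' t' : List Dir} {u v w w' : Word T}

theorem Conv.refl (u : Word T) : Conv M s t u u := Relation.EqvGen.refl u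

theorem Conv.symm (h : Conv M s t u v) : Conv M s t v u := Relation.EqvGen.symm _ _ h

theorem Conv.trans (h : Conv M s t u v) (h' : Conv M s t v w) : Conv M s t u w :=
  Relation.EqvGen.trans _ _ _ h h'

theorem Conv.of_move (h : M s t u v) (hu : IsTangle s u t) (hv : IsTangle s v t) :
    Conv M s t u v :=
  .rel _ _ ⟨[], [], s, t, u, v, [], [], h, hu, hv, by simpa using IsTangle.nil s,
    by simpa using IsTangle.nil t, by simp [shift_zero], by simp [shift_zero]⟩

theorem Conv.context {S U l r : List Dir} {below above : Word T} (h : Conv M s t u v)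
    (hb : IsTangle S below (l ++ s ++ r)) (ha : IsTangle (l ++ t ++ r) above U) :
    Conv M S U (below ++ shift l.length u ++ above) (below ++ shift l.length v ++ above) := by
  induction h with
  | refl => exact .refl _
  | symm _ _ _ ih => exact ih.symm
  | trans _ _ _ _ _ ih₁ ih₂ => exact ih₁.trans ih₂
  | rel _ _ h =>
    obtain ⟨l', r', s', t', u', v', below', above', hM, hu, hv, hb', ha', rfl, rfl⟩ := h
    refine .rel _ _ ⟨l ++ l', r' ++ r, s', t', u', v', below ++ shift l.length below',
      shift l.length above' ++ above, hM, hu, hv, ?_, ?_, ?_, ?_⟩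
    · exact hb.append (by simpa using hb'.context l r)
    · exact IsTangle.append (by simpa using ha'.context l r) ha
    · simp [shift_append, shift_shift]
    · simp [shift_append, shift_shift]

theorem LocalStep.isTangle (h : LocalStep M s t u v) : IsTangle s u t ∧ IsTangle s v t := by
  obtain ⟨l, r, s', t', u', v', below, above, -, hu, hv, hb, ha, rfl, rfl⟩ := h
  exact ⟨(hb.append (hu.context l r)).append ha, (hb.append (hv.context l r)).append ha⟩

theorem Conv.isTangle_iff (h : Conv M s t u v) : IsTangle s u t ↔ IsTangle s v t := by
  induction h with
  | refl => rfl
  | symm _ _ _ ih => exact ih.symm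
  | trans _ _ _ _ _ ih₁ ih₂ => exact ih₁.trans ih₂
  | rel _ _ h => exact iff_of_true h.isTangle.1 h.isTangle.2

/-- Each direction of the main theorem is an instance, so only single moves without surroundings
need to be derived. -/
theorem Conv.of_le (hMN : ∀ s t u v, M s t u v → IsTangle s u t → IsTangle s v t → Conv N s t u v)
    (h : Conv M s t u v) : Conv N s t u v := by
  induction h with
  | refl => exact .refl _
  | symm _ _ _ ih => exact ih.symm
  | trans _ _ _ _ _ ih₁ ih₂ => exact ih₁.trans ih₂
  | rel _ _ h =>
    obtain ⟨l, r, s', t', u', v', below, above, hM, hu, hv, hb, ha, rfl, rfl⟩ := h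
    exact (hMN _ _ _ _ hM hu hv).context hb ha

/-- Chains of words lose nothing against chains of diagrams: a step relates only well-typed words,
so every intermediate word is again a diagram. -/
theorem related_iff_conv {D D' : Diagram T} : Related M D D' ↔ Conv M [] [] D.word D'.word := by
  constructor
  · intro h
    induction h with
    | refl => exact .refl _
    | symm _ _ _ ih => exact ih.symm
    | trans _ _ _ _ _ ih₁ ih₂ => exact ih₁.trans ih₂
    | rel _ _ h => exact .rel _ _ h
  · intro h
    obtain ⟨w, hw⟩ := D
    obtain ⟨w', hw'⟩ := D'
    dsimp only at h
    induction h with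
    | refl => exact .refl _
    | symm _ _ _ ih => exact .symm _ _ (ih _ _)
    | trans _ y _ h₁ _ ih₁ ih₂ =>
      have hy : IsTangle [] y [] := (Conv.isTangle_iff h₁).1 hw
      exact Relation.EqvGen.trans (r := Step M) _ _ _ (ih₁ hw hy) (ih₂ hy hw')
    | rel _ _ h => exact .rel _ _ h

/-- Rewriting with a local equivalence at height `i` and horizontal position `n`. -/
theorem Conv.rw {above : Word T} (i n : ℕ) (h : Conv M s' t' u v)
    (hw : w.drop i = shift n u ++ above)
    (ht : ((run s (w.take i)).bind (replaceAt s' t' n)).bind (run · above) = some t) :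
    Conv M s t w (w.take i ++ shift n v ++ above) := by
  simp only [Option.bind_eq_some_iff] at ht
  obtain ⟨m, ⟨m', h₁, h₂⟩, h₃⟩ := ht
  obtain ⟨l, r, rfl, rfl, rfl⟩ := replaceAt_eq_some h₂
  have := h.context (IsTangle.of_run h₁) (IsTangle.of_run h₃)
  rwa [List.append_assoc, ← hw, List.take_append_drop] at this

/-- As `Conv.rw`, for a local equivalence with a side condition. -/
theorem Conv.rwOf {P : Prop} {above : Word T} (i n : ℕ) (h : P → Conv M s' t' u v)
    (hw : w.drop i = shift n u ++ above)
    (ht : ((run s (w.take i)).bind (replaceAt s' t' n)).bind (run · above) = some t) (hP : P) :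
    Conv M s t w (w.take i ++ shift n v ++ above) :=
  .rw i n (h hP) hw ht

/-- The family of moves `M` contains all planar isotopies. -/
def HasIsotopy (M : Moves T) : Prop := ∀ s t u v, Isotopy s t u v → M s t u v

theorem IsTangle.exchange_lower (p q : Piece T) (m : List Dir) :
    IsTangle (p.bottom ++ m ++ q.bottom)
      [⟨0, p⟩, ⟨p.top.length + m.length, q⟩] (p.top ++ m ++ q.top) :=
  isTangle_cons_iff.2 ⟨[], m ++ q.bottom, rfl, by simp,
    isTangle_cons_iff.2 ⟨p.top ++ m, [], by simp, by simp, by simpa using IsTangle.nil _⟩⟩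

theorem IsTangle.exchange_upper (p q : Piece T) (m : List Dir) :
    IsTangle (p.bottom ++ m ++ q.bottom)
      [⟨p.bottom.length + m.length, q⟩, ⟨0, p⟩] (p.top ++ m ++ q.top) :=
  isTangle_cons_iff.2 ⟨p.bottom ++ m, [], by simp, by simp,
    isTangle_cons_iff.2 ⟨[], m ++ q.top, rfl, by simp, by simpa using IsTangle.nil _⟩⟩

theorem Conv.exchange (hM : HasIsotopy M) (p q : Piece T) (m : List Dir) :
    Conv M (p.bottom ++ m ++ q.bottom) (p.top ++ m ++ q.top)
      [⟨0, p⟩, ⟨p.top.length + m.length, q⟩] [⟨p.bottom.length + m.length, q⟩, ⟨0, p⟩] :=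
  .of_move (hM _ _ _ _ (.exchange p q m)) (.exchange_lower p q m) (.exchange_upper p q m)

/-- Move a slice below its predecessor, which lies to the left of it. -/
def swapRight (σ τ : Slice T) : Word T :=
  [⟨τ.offset - σ.piece.top.length + σ.piece.bottom.length, τ.piece⟩, σ]

/-- Move a slice below its predecessor, which lies to the right of it. -/
def swapLeft (σ τ : Slice T) : Word T :=
  [τ, ⟨σ.offset - τ.piece.bottom.length + τ.piece.top.length, σ.piece⟩]

theorem Conv.swapRight (hM : HasIsotopy M) {σ τ : Slice T} {above : Word T} (i : ℕ)
    (hw : w.drop i = σ :: τ :: above) (hστ : Nat.ble (σ.offset + σ.piece.top.length) τ.offset)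
    (ht : run s w = some t) : Conv M s t w (w.take i ++ (MultiVirtual.swapRight σ τ ++ above)) := by
  have h := IsTangle.of_run ht
  rw [← List.take_append_drop i w] at h
  obtain ⟨m, h₁, h₂⟩ := h.of_append
  rw [hw] at h₂
  obtain ⟨o, p⟩ := σ
  obtain ⟨o', q⟩ := τ
  obtain ⟨l, r, rfl, rfl, h₃⟩ := isTangle_cons_iff.1 h₂
  obtain ⟨l', r', rfl, h₄, h₅⟩ := isTangle_cons_iff.1 h₃
  have hle : l.length + p.top.length ≤ l'.length := Nat.le_of_ble_eq_true hστ
  obtain ⟨k, rfl⟩ : l ++ p.top <+: l' :=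
    List.prefix_of_prefix_length_le (l₃ := l ++ p.top ++ r) ⟨r, rfl⟩
      ⟨q.bottom ++ r', by rw [h₄]; simp⟩ (by simpa using hle)
  obtain rfl : r = k ++ q.bottom ++ r' := by simpa using h₄
  have := (Conv.exchange hM p q k).context (l := l) (r := r') (by simpa using h₁)
    (by simpa using h₅)
  -- The truncated subtraction is exact, since the upper slice starts to the right of all upper ends
  -- of the lower one.
  have e : l.length + (p.top.length + k.length) - p.top.length + p.bottom.length =
    l.length + (p.bottom.length + k.length) := by omega
  conv => arg 4; rw [← List.take_append_drop i w, hw]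
  simpa [shift, MultiVirtual.swapRight, Nat.add_assoc, e] using this

theorem Conv.swapLeft (hM : HasIsotopy M) {σ τ : Slice T} {above : Word T} (i : ℕ)
    (hw : w.drop i = σ :: τ :: above)
    (hστ : Nat.ble (τ.offset + τ.piece.bottom.length) σ.offset)
    (ht : run s w = some t) : Conv M s t w (w.take i ++ (MultiVirtual.swapLeft σ τ ++ above)) := by
  have h := IsTangle.of_run ht
  rw [← List.take_append_drop i w] at h
  obtain ⟨m, h₁, h₂⟩ := h.of_append
  rw [hw] at h₂
  obtain ⟨o, p⟩ := σ
  obtain ⟨o', q⟩ := τ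
  obtain ⟨l, r, rfl, rfl, h₃⟩ := isTangle_cons_iff.1 h₂
  obtain ⟨l', r', rfl, h₄, h₅⟩ := isTangle_cons_iff.1 h₃
  have hle : l'.length + q.bottom.length ≤ l.length := Nat.le_of_ble_eq_true hστ
  obtain ⟨k, rfl⟩ : l' ++ q.bottom <+: l :=
    List.prefix_of_prefix_length_le (l₃ := l ++ p.top ++ r) ⟨r', by rw [h₄]⟩
      ⟨p.top ++ r, by simp⟩ (by simpa using hle)
  obtain rfl : k ++ p.top ++ r = r' := by simpa using h₄
  have := ((Conv.exchange hM q p k).context (l := l') (r := r) (by simpa using h₁)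
    (by simpa using h₅)).symm
  have e : l'.length + (q.bottom.length + k.length) - q.bottom.length + q.top.length =
    l'.length + (q.top.length + k.length) := by omega
  conv => arg 4; rw [← List.take_append_drop i w, hw]
  simpa [shift, MultiVirtual.swapLeft, Nat.add_assoc, e] using this

/-! ### Basic isotopies as rewriting rules -/

namespace Conv

/-- The separate direction `e` lets the rule match words in which it is not written as `d.rev`; the
side condition is checked after matching, through `Conv.rwOf`. -/
theorem zigzagRight (hM : HasIsotopy M) {d e : Dir} (he : e = d.rev) :
    Conv M [d] [d] [⟨1, .cup e⟩, ⟨0, .cap d⟩] [] := by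
  subst he
  exact .of_move (hM _ _ _ _ (.zigzagRight d)) (by cases d <;> exact .of_run rfl) (.nil _)

theorem zigzagLeft (hM : HasIsotopy M) {d e : Dir} (he : e = d.rev) :
    Conv M [d] [d] [⟨0, .cup d⟩, ⟨1, .cap e⟩] [] := by
  subst he
  exact .of_move (hM _ _ _ _ (.zigzagLeft d)) (by cases d <;> exact .of_run rfl) (.nil _)

theorem capSlide (hM : HasIsotopy M) {x y : Crossing T} {a b c : Dir}
    (h : y = x.turn ∧ c = b.rev) :
    Conv M [b, a, c] [a] [⟨0, .cross x b a⟩, ⟨1, .cap b⟩] [⟨1, .cross y a c⟩, ⟨0, .cap b⟩] := by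
  obtain ⟨rfl, rfl⟩ := h
  exact .of_move (hM _ _ _ _ (.capSlide x a b)) (by cases a <;> cases b <;> exact .of_run rfl)
    (by cases a <;> cases b <;> exact .of_run rfl)

theorem capSlide' (hM : HasIsotopy M) {x y : Crossing T} {a b c : Dir}
    (h : y = x.turn ∧ c = b.rev) :
    Conv M [b, a, c] [a] [⟨1, .cross x a c⟩, ⟨0, .cap b⟩] [⟨0, .cross y b a⟩, ⟨1, .cap b⟩] :=
  (capSlide hM ⟨by rw [h.1, Crossing.turn_turn], h.2⟩).symm

theorem cupSlide (hM : HasIsotopy M) {x y : Crossing T} {a b c : Dir}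
    (h : y = x.turn ∧ c = b.rev) :
    Conv M [a] [b, a, c] [⟨1, .cup b⟩, ⟨0, .cross x a b⟩] [⟨0, .cup b⟩, ⟨1, .cross y c a⟩] := by
  obtain ⟨rfl, rfl⟩ := h
  exact .of_move (hM _ _ _ _ (.cupSlide x a b)) (by cases a <;> cases b <;> exact .of_run rfl)
    (by cases a <;> cases b <;> exact .of_run rfl)

theorem cupSlide' (hM : HasIsotopy M) {x y : Crossing T} {a b c : Dir}
    (h : y = x.turn ∧ c = b.rev) :
    Conv M [a] [b, a, c] [⟨0, .cup b⟩, ⟨1, .cross x c a⟩] [⟨1, .cup b⟩, ⟨0, .cross y a b⟩] :=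
  (cupSlide hM ⟨by rw [h.1, Crossing.turn_turn], h.2⟩).symm

end Conv

/-- Up to the moves `M`, the Reidemeister 3 move is available for the given triangle. -/
def Triangle (M : Moves T) (x y z : Crossing T) (a b c : Dir) : Prop :=
  Conv M [a, b, c] [c, b, a] (triangleLeft x y z a b c) (triangleRight x y z a b c)

/-- Up to the moves `M`, the given bigon can be removed. -/
def Bigon (M : Moves T) (x : Crossing T) (a b : Dir) : Prop :=
  Conv M [a, b] [a, b] (bigon x a b) []

/-- Up to the moves `M`, a loop on the right can be removed. -/
def LoopRight (M : Moves T) (x : Crossing T) (d : Dir) : Prop :=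
  Conv M [d] [d] (loopRight x d) []

/-- Up to the moves `M`, a loop on the left can be removed. -/
def LoopLeft (M : Moves T) (x : Crossing T) (d : Dir) : Prop :=
  Conv M [d] [d] (loopLeft x d) []

/-! ### Symmetries of triangles, bigons and loops -/

variable {x y z k : Crossing T} {a b c e : Dir}

/-- The first strand is bent by a minimum on the left and a maximum on the right. Sliding these
through its two crossings turns each crossing by a quarter; straightening the remaining zigzag
leaves a triangle of the other shape. -/
theorem rotate_triangleRight (hM : HasIsotopy M) (x y z : Crossing T) (a b c : Dir) :
    Conv M [b, c, a.rev] [a.rev, c, b]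
      (⟨0, .cup a.rev⟩ :: (shift 1 (triangleRight x y z a b c) ++ [⟨3, .cap a⟩]))
      (triangleLeft z x.turn y.turn b c a.rev) := by
  cases a <;> cases b <;> cases c <;>
  exact .trans (.rwOf 3 2 (.capSlide hM) rfl rfl ⟨rfl, rfl⟩) <|
    .trans (.swapRight hM 2 rfl rfl rfl) <|
    .trans (.rwOf 3 1 (.capSlide hM) rfl rfl ⟨rfl, rfl⟩) <|
    .trans (.swapRight hM 0 rfl rfl rfl) <|
    .trans (.swapRight hM 1 rfl rfl rfl) <|
    .trans (.swapRight hM 2 rfl rfl rfl) <|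
    .rwOf 3 0 (.zigzagLeft hM) rfl rfl rfl

theorem rotate_triangleLeft (hM : HasIsotopy M) (x y z : Crossing T) (a b c : Dir) :
    Conv M [b, c, a.rev] [a.rev, c, b]
      (⟨0, .cup a.rev⟩ :: (shift 1 (triangleLeft x y z a b c) ++ [⟨3, .cap a⟩]))
      (triangleRight z x.turn y.turn b c a.rev) := by
  cases a <;> cases b <;> cases c <;>
  exact .trans (.swapRight hM 3 rfl rfl rfl) <|
    .trans (.rwOf 2 2 (.capSlide hM) rfl rfl ⟨rfl, rfl⟩) <|
    .trans (.swapRight hM 1 rfl rfl rfl) <|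
    .trans (.rwOf 2 1 (.capSlide hM) rfl rfl ⟨rfl, rfl⟩) <|
    .trans (.swapRight hM 0 rfl rfl rfl) <|
    .trans (.swapRight hM 1 rfl rfl rfl) <|
    .rwOf 2 0 (.zigzagLeft hM) rfl rfl rfl

/-- Rotation of a triangle by a sixth of a full turn. -/
theorem Triangle.rotate (hM : HasIsotopy M) (h : Triangle M x y z a b c) :
    Triangle M z x.turn y.turn b c a.rev := by
  refine (rotate_triangleRight hM x y z a b c).symm.trans
    (.trans ?_ (rotate_triangleLeft hM x y z a b c))
  exact (Conv.context (S := [b, c, a.rev]) (U := [a.rev, c, b]) (l := [a.rev]) (r := [a.rev])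
    (below := [⟨0, .cup a.rev⟩]) (above := [⟨3, .cap a⟩]) h.symm
    (by cases a <;> cases b <;> cases c <;> exact .of_run rfl)
    (by cases a <;> cases b <;> cases c <;> exact .of_run rfl) :)

/-- Rotation of a triangle in the opposite sense. -/
theorem Triangle.rotate' (hM : HasIsotopy M) (h : Triangle M x y z a b c) :
    Triangle M y.turn z.turn x c.rev a b := by
  -- Six rotations are the identity, so five of them invert one.
  simpa only [Crossing.turn_turn, Dir.rev_rev] using
    (((h.rotate hM).rotate hM).rotate hM |>.rotate hM).rotate hM

/-- Exchange of the first two strands of a triangle. -/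
theorem Triangle.swap_left (h₁ : Bigon M x a b) (h₂ : Bigon M x.turn b a)
    (h : Triangle M x y z a b c) : Triangle M x.turn z y b a c := by
  simp only [Bigon, bigon, Crossing.turn_turn] at h₁ h₂
  -- Conjugation by a crossing: a bigon is created above the triangle, the known triangle move
  -- absorbs its lower crossing, and the opposite bigon then cancels at the bottom.
  have e₁ : Conv M [b, a, c] [c, a, b]
      (triangleLeft x.turn z y b a c ++ shift 1 (bigon x a b))
      (triangleLeft x.turn z y b a c) := by
    cases a <;> cases b <;> cases c <;> exact .rw 3 1 h₁ rfl rfl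
  have e₂ : Conv M [b, a, c] [c, a, b]
      (triangleLeft x.turn z y b a c ++ shift 1 (bigon x a b))
      (triangleRight x.turn z y b a c) := by
    cases a <;> cases b <;> cases c <;>
    exact .trans (.rw 1 0 h.symm rfl rfl) (.rw 0 0 h₂ rfl rfl)
  exact e₁.symm.trans e₂

/-- Exchange of the last two strands of a triangle. -/
theorem Triangle.swap_right (h₁ : Bigon M z b c) (h₂ : Bigon M z.turn c b)
    (h : Triangle M x y z a b c) : Triangle M y x z.turn a c b := by
  simp only [Bigon, bigon, Crossing.turn_turn] at h₁ h₂
  have e₁ : Conv M [a, c, b] [b, c, a]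
      ([⟨1, .cross z.turn c b⟩, ⟨1, .cross z b c⟩] ++ triangleLeft y x z.turn a c b)
      (triangleLeft y x z.turn a c b) := by
    cases a <;> cases b <;> cases c <;> exact .rw 0 1 h₂ rfl rfl
  have e₂ : Conv M [a, c, b] [b, c, a]
      ([⟨1, .cross z.turn c b⟩, ⟨1, .cross z b c⟩] ++ triangleLeft y x z.turn a c b)
      (triangleRight y x z.turn a c b) := by
    cases a <;> cases b <;> cases c <;>
    exact .trans (.rw 1 0 h.symm rfl rfl) (.rw 3 0 h₁ rfl rfl)
  exact e₁.symm.trans e₂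

/-- Rotation of a bigon by a half turn. -/
theorem Bigon.rotate (hM : HasIsotopy M) (h : Bigon M x b a) :
    Bigon M x.turn a.rev b.rev := by
  obtain ⟨y, hy⟩ : ∃ y, y = x.turn := ⟨_, rfl⟩
  have hx : x = y.turn := by rw [hy, Crossing.turn_turn]
  simp only [Bigon, bigon, ← hx, ← hy] at h ⊢
  -- Both strands are bent into nested zigzags around the given bigon. Removing the bigon
  -- straightens everything; sliding its crossings out through the extrema gives the rotated bigon
  -- instead.
  have e₁ : Conv M [a.rev, b.rev] [a.rev, b.rev]
      [⟨0, .cup a.rev⟩, ⟨1, .cup b.rev⟩, ⟨2, .cross x b a⟩, ⟨2, .cross y a b⟩, ⟨3, .cap a⟩,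
        ⟨2, .cap b⟩] [] := by
    cases a <;> cases b <;>
    exact .trans (.rw 2 2 h rfl rfl) <|
      .trans (.swapRight hM 1 rfl rfl rfl) <|
      .trans (.rwOf 0 0 (.zigzagLeft hM) rfl rfl rfl) <|
      .rwOf 0 1 (.zigzagLeft hM) rfl rfl rfl
  have e₂ : Conv M [a.rev, b.rev] [a.rev, b.rev]
      [⟨0, .cup a.rev⟩, ⟨1, .cup b.rev⟩, ⟨2, .cross x b a⟩, ⟨2, .cross y a b⟩, ⟨3, .cap a⟩,
        ⟨2, .cap b⟩] [⟨0, .cross y a.rev b.rev⟩, ⟨0, .cross x b.rev a.rev⟩] := by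
    cases a <;> cases b <;>
    exact .trans (.rwOf 3 2 (.capSlide hM) rfl rfl ⟨hx, rfl⟩) <|
      .trans (.rwOf 1 1 (.cupSlide' hM) rfl rfl ⟨hy, rfl⟩) <|
      .trans (.swapRight hM 0 rfl rfl rfl) <|
      .trans (.swapRight hM 2 rfl rfl rfl) <|
      .trans (.swapRight hM 1 rfl rfl rfl) <|
      .trans (.swapRight hM 4 rfl rfl rfl) <|
      .trans (.swapRight hM 3 rfl rfl rfl) <|
      .trans (.swapRight hM 2 rfl rfl rfl) <|
      .trans (.rwOf 0 0 (.cupSlide' hM) rfl rfl ⟨hy, rfl⟩) <|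
      .trans (.swapRight hM 1 rfl rfl rfl) <|
      .trans (.rwOf 0 1 (.zigzagLeft hM) rfl rfl rfl) <|
      .trans (.rwOf 1 0 (.cupSlide' hM) rfl rfl ⟨hx, rfl⟩) <|
      .trans (.swapRight hM 2 rfl rfl rfl) <|
      .rwOf 1 1 (.zigzagLeft hM) rfl rfl rfl
  exact e₂.symm.trans e₁

/-- A loop on the left of a strand, near a maximum. -/
theorem LoopLeft.twist (hM : HasIsotopy M) (h : LoopLeft M x a) :
    Conv M [a, a.rev] [] [⟨0, .cross x.turn a a.rev⟩, ⟨0, .cap a.rev⟩] [⟨0, .cap a⟩] := by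
  have e₁ : Conv M [a, a.rev] [] (loopLeft x a ++ [⟨0, .cap a⟩]) [⟨0, .cap a⟩] := by
    cases a <;> exact .rw 0 0 h rfl rfl
  have e₂ : Conv M [a, a.rev] [] (loopLeft x a ++ [⟨0, .cap a⟩])
      [⟨0, .cross x.turn a a.rev⟩, ⟨0, .cap a.rev⟩] := by
    cases a <;>
    exact .trans (.swapRight hM 2 rfl rfl rfl) <|
      .trans (.rwOf 1 1 (.capSlide hM) rfl rfl ⟨rfl, rfl⟩) <|
      .trans (.swapRight hM 0 rfl rfl rfl) <|
      .rwOf 1 0 (.zigzagLeft hM) rfl rfl rfl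
  exact e₂.symm.trans e₁

/-- A loop on the right of a strand, near a maximum. -/
theorem LoopRight.twist (hM : HasIsotopy M) (h : LoopRight M x a) :
    Conv M [a.rev, a] [] [⟨0, .cross x.turn a.rev a⟩, ⟨0, .cap a⟩] [⟨0, .cap a.rev⟩] := by
  have e₁ : Conv M [a.rev, a] [] (shift 1 (loopRight x a) ++ [⟨0, .cap a.rev⟩])
      [⟨0, .cap a.rev⟩] := by
    cases a <;> exact .rw 0 1 h rfl rfl
  have e₂ : Conv M [a.rev, a] [] (shift 1 (loopRight x a) ++ [⟨0, .cap a.rev⟩])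
      [⟨0, .cross x.turn a.rev a⟩, ⟨0, .cap a⟩] := by
    cases a <;>
    exact .trans (.swapLeft hM 2 rfl rfl rfl) <|
      .trans (.rwOf 1 0 (.capSlide' hM) rfl rfl ⟨rfl, rfl⟩) <|
      .trans (.swapLeft hM 0 rfl rfl rfl) <|
      .rwOf 1 1 (.zigzagRight hM) rfl rfl rfl
  exact e₂.symm.trans e₁

/-- Sliding the minimum of the loop through its crossing exposes a twisted maximum, which
`LoopLeft.twist` untwists; a zigzag remains. -/
theorem LoopLeft.rotate (hM : HasIsotopy M) (h : LoopLeft M x a) : LoopRight M x a.rev := by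
  have h' := h.twist hM
  cases a <;>
  exact .trans (.rwOf 0 0 (.cupSlide hM) rfl rfl ⟨rfl, rfl⟩) <|
    .trans (.rw 1 1 h' rfl rfl) <|
    .rwOf 0 0 (.zigzagLeft hM) rfl rfl rfl

theorem LoopRight.rotate (hM : HasIsotopy M) (h : LoopRight M x a) : LoopLeft M x a.rev := by
  have h' := h.twist hM
  cases a <;>
  exact .trans (.rwOf 0 0 (.cupSlide' hM) rfl rfl ⟨rfl, rfl⟩) <|
    .trans (.rw 1 0 h' rfl rfl) <|
    .rwOf 0 0 (.zigzagRight hM) rfl rfl rfl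

/-- A bigon turns a loop into the loop of opposite sign on the other side. -/
theorem LoopLeft.opposite (hM : HasIsotopy M) (h : LoopLeft M x a) (hb : Bigon M x a.rev a) :
    LoopRight M x.turn a := by
  have h' := h.twist hM
  -- A bigon is inserted below the maximum of a zigzag. The given loop absorbs its upper crossing,
  -- and the lower one is left as the crossing of the new loop.
  have e₁ : Conv M [a] [a]
      (⟨0, .cup a⟩ :: (shift 1 (bigon x a.rev a) ++ [⟨1, .cap a.rev⟩])) [] := by
    cases a <;>
    exact .trans (.rw 1 1 hb rfl rfl) (.rwOf 0 0 (.zigzagLeft hM) rfl rfl rfl)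
  have e₂ : Conv M [a] [a]
      (⟨0, .cup a⟩ :: (shift 1 (bigon x a.rev a) ++ [⟨1, .cap a.rev⟩])) (loopRight x.turn a) := by
    cases a <;>
    exact .trans (.rw 2 1 h' rfl rfl) (.rwOf 0 0 (.cupSlide' hM) rfl rfl ⟨rfl, rfl⟩)
  exact e₂.symm.trans e₁

theorem LoopRight.opposite (hM : HasIsotopy M) (h : LoopRight M x a) (hb : Bigon M x a a.rev) :
    LoopLeft M x.turn a := by
  have h' := h.twist hM
  have e₁ : Conv M [a] [a]
      (⟨1, .cup a.rev⟩ :: (bigon x a a.rev ++ [⟨0, .cap a⟩])) [] := by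
    cases a <;>
    exact .trans (.rw 1 0 hb rfl rfl) (.rwOf 0 0 (.zigzagRight hM) rfl rfl rfl)
  have e₂ : Conv M [a] [a]
      (⟨1, .cup a.rev⟩ :: (bigon x a a.rev ++ [⟨0, .cap a⟩])) (loopLeft x.turn a) := by
    cases a <;>
    exact .trans (.rw 2 0 h' rfl rfl) (.rwOf 0 0 (.cupSlide hM) rfl rfl ⟨rfl, rfl⟩)
  exact e₂.symm.trans e₁

/-- A bigon to the right of a strand `a` is obtained by adding a loop to `a`, letting the loop form
a bigon with the other strand, and moving this strand across the crossing of the loop. -/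
theorem LoopRight.bigon (hM : HasIsotopy M) (hl : LoopRight M k a) (hb : Bigon M x a.rev e)
    (ht : Triangle M x k x.turn a e a) : Bigon M x a e := by
  obtain ⟨y, hy⟩ : ∃ y, y = x.turn := ⟨_, rfl⟩
  have hx : x = y.turn := by rw [hy, Crossing.turn_turn]
  simp only [Bigon, MultiVirtual.bigon, ← hy] at hb ht ⊢
  have e₁ : Conv M [a, e] [a, e] [⟨1, .cup a⟩, ⟨2, .cross x a.rev e⟩, ⟨2, .cross y e a.rev⟩,
      ⟨0, .cross k a a⟩, ⟨1, .cap a⟩] [] := by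
    cases a <;> cases e <;>
    exact .trans (.rw 1 2 hb rfl rfl) (.rw 0 0 hl rfl rfl)
  have e₂ : Conv M [a, e] [a, e] [⟨1, .cup a⟩, ⟨2, .cross x a.rev e⟩, ⟨2, .cross y e a.rev⟩,
      ⟨0, .cross k a a⟩, ⟨1, .cap a⟩] [⟨0, .cross x a e⟩, ⟨0, .cross y e a⟩] := by
    cases a <;> cases e <;>
    exact .trans (.swapLeft hM 2 rfl rfl rfl) <|
      .trans (.rwOf 3 1 (.capSlide' hM) rfl rfl ⟨hx, rfl⟩) <|
      .trans (.rwOf 0 1 (.cupSlide' hM) rfl rfl ⟨hy, rfl⟩) <|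
      .trans (.rw 1 0 ht.symm rfl rfl) <|
      .trans (.swapLeft hM 0 rfl rfl rfl) <|
      .trans (.swapRight hM 3 rfl rfl rfl) <|
      .rw 1 1 hl rfl rfl
  exact e₂.symm.trans e₁

/-- The counterpart of `LoopRight.bigon` with the loop on the left of `a`, and hence with `e` on the
left. -/
theorem LoopLeft.bigon (hM : HasIsotopy M) (hl : LoopLeft M k a) (hb : Bigon M x.turn e a.rev)
    (ht : Triangle M x k x.turn a e a) : Bigon M x.turn e a := by
  obtain ⟨y, hy⟩ : ∃ y, y = x.turn := ⟨_, rfl⟩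
  have hx : x = y.turn := by rw [hy, Crossing.turn_turn]
  simp only [Bigon, MultiVirtual.bigon, ← hy, ← hx] at hb ht ⊢
  have e₁ : Conv M [e, a] [e, a] [⟨1, .cup a.rev⟩, ⟨0, .cross y e a.rev⟩, ⟨0, .cross x a.rev e⟩,
      ⟨2, .cross k a a⟩, ⟨1, .cap a.rev⟩] [] := by
    cases a <;> cases e <;>
    exact .trans (.rw 1 0 hb rfl rfl) (.rw 0 1 hl rfl rfl)
  have e₂ : Conv M [e, a] [e, a] [⟨1, .cup a.rev⟩, ⟨0, .cross y e a.rev⟩, ⟨0, .cross x a.rev e⟩,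
      ⟨2, .cross k a a⟩, ⟨1, .cap a.rev⟩] [⟨0, .cross y e a⟩, ⟨0, .cross x a e⟩] := by
    cases a <;> cases e <;>
    exact .trans (.swapRight hM 2 rfl rfl rfl) <|
      .trans (.rwOf 0 0 (.cupSlide hM) rfl rfl ⟨hx, rfl⟩) <|
      .trans (.rwOf 3 0 (.capSlide hM) rfl rfl ⟨hy, rfl⟩) <|
      .trans (.rw 1 1 ht rfl rfl) <|
      .trans (.swapRight hM 0 rfl rfl rfl) <|
      .trans (.swapLeft hM 3 rfl rfl rfl) <|
      .rw 1 0 hl rfl rfl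
  exact e₂.symm.trans e₁

variable {d : Dir}

/-! ### Generation of the remaining oriented moves -/

/-- Loops of one sign, one bigon and one coherently oriented triangle give all bigons, the loops of
the other sign, and a braid-like triangle. -/
theorem generate (hM : HasIsotopy M) (hR : LoopRight M x .up) (hL : LoopLeft M x .up)
    (hB : Bigon M x .up .up ∨ Bigon M x.turn .up .up)
    (hT : Triangle M x.turn x.turn x.turn .up .down .up) :
    (∀ a b, Bigon M x a b ∧ Bigon M x.turn a b) ∧
      LoopRight M x.turn .up ∧ LoopLeft M x.turn .up ∧ Triangle M x x x .up .up .up := by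
  -- A third of a turn preserves the alternating directions but changes which crossings are turned.
  have hT₁ : Triangle M x x x.turn .up .down .up := by
    simpa only [Crossing.turn_turn, Dir.rev] using (hT.rotate hM).rotate hM
  have hT₂ : Triangle M x.turn x x .up .down .up := by
    simpa only [Crossing.turn_turn, Dir.rev] using (hT₁.rotate hM).rotate hM
  -- One parallel bigon gives the antiparallel ones: the loop presents a reversed piece of the
  -- strand `.up`, where the downward bigon applies. A half turn then covers both choices of the
  -- overpass.
  have anti : ∀ y, Triangle M y x y.turn .up .down .up →
      Triangle M y.turn x y .up .down .up → Bigon M y .down .down →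
      ∀ z, z = y ∨ z = y.turn → Bigon M z .up .down ∧ Bigon M z .down .up := by
    intro y h₁ h₂ h₃
    have h₄ : Bigon M y .up .down := hR.bigon hM h₃ h₁
    have h₅ : Bigon M y .down .up := by
      have := hL.bigon (x := y.turn) (e := .down) hM (by rwa [Crossing.turn_turn])
        (by rwa [Crossing.turn_turn])
      rwa [Crossing.turn_turn] at this
    rintro z (rfl | rfl)
    · exact ⟨h₄, h₅⟩
    · exact ⟨h₄.rotate hM, h₅.rotate hM⟩
  have hanti : ∀ z, z = x ∨ z = x.turn → Bigon M z .up .down ∧ Bigon M z .down .up := by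
    rcases hB with hB | hB
    · have := anti x.turn (by rwa [Crossing.turn_turn]) (by rwa [Crossing.turn_turn])
        (hB.rotate hM)
      rw [Crossing.turn_turn] at this
      exact fun z hz => this z hz.symm
    · have := hB.rotate hM
      rw [Crossing.turn_turn] at this
      exact anti x hT₁ hT₂ this
  obtain ⟨h₁, h₂⟩ := hanti x (.inl rfl)
  obtain ⟨h₃, h₄⟩ := hanti x.turn (.inr rfl)
  have hR' : LoopRight M x.turn .up := hL.opposite hM h₂
  have hL' : LoopLeft M x.turn .up := hR.opposite hM h₁
  -- Exchanging antiparallel sides of the coherent triangle and rotating makes all three strands run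
  -- upward.
  have hT₃ : Triangle M x.turn x.turn x .up .up .up := by
    have := hT.swap_left h₃ (by rwa [Crossing.turn_turn])
    rw [Crossing.turn_turn] at this
    simpa only [Crossing.turn_turn, Dir.rev] using this.rotate hM
  have hT₄ : Triangle M x x.turn x.turn .up .up .up := by
    have := hT.swap_right h₄ (by rwa [Crossing.turn_turn])
    rw [Crossing.turn_turn] at this
    simpa only [Crossing.turn_turn, Dir.rev] using this.rotate' hM
  -- The loop argument again, now from antiparallel to parallel bigons, using the new loop and the
  -- braid-like triangles. This also supplies the parallel bigon with the overpass not given in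
  -- `hB`.
  have h₅ : Bigon M x .up .up := hR'.bigon hM h₂ hT₄
  have h₆ : Bigon M x.turn .up .up := hR'.bigon hM h₄ (by rwa [Crossing.turn_turn])
  have h₇ : Bigon M x.turn .down .down := h₅.rotate hM
  have h₈ : Bigon M x .down .down := by
    simpa only [Crossing.turn_turn, Dir.rev] using h₆.rotate hM
  refine ⟨?_, hR', hL', ?_⟩
  · rintro (_ | _) (_ | _)
    exacts [⟨h₅, h₆⟩, ⟨h₁, h₃⟩, ⟨h₂, h₄⟩, ⟨h₈, h₇⟩]
  · have h₉ := hT₃.swap_left h₆ (by rwa [Crossing.turn_turn])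
    rw [Crossing.turn_turn] at h₉
    simpa only [Crossing.turn_turn, Dir.rev] using h₉.swap_right h₆ (by rwa [Crossing.turn_turn])

/-- If the braid-like triangles are available for a family of crossings which is closed
under rotation and exchange of strands, then so are the triangles of all orientations. -/
theorem triangle_of_up (hM : HasIsotopy M) {K : Crossing T → Crossing T → Crossing T → Prop}
    (hB : ∀ x y z, K x y z → ∀ a b, Bigon M x a b ∧ Bigon M x.turn a b)
    (hrot : ∀ x y z, K x y z → K z x.turn y.turn) (hswap : ∀ x y z, K x y z → K x.turn z y)
    (hT : ∀ x y z, K x y z → Triangle M x y z .up .up .up) (h : K x y z) (a b c : Dir) :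
    Triangle M x y z a b c := by
  have rot : ∀ a b c, (∀ x y z, K x y z → Triangle M x y z b c a.rev) →
      ∀ x y z, K x y z → Triangle M x y z a b c := by
    intro a b c h x y z hK
    simpa only [Crossing.turn_turn, Dir.rev_rev] using (h _ _ _ (hrot _ _ _ hK)).rotate' hM
  have swap : ∀ a b c, (∀ x y z, K x y z → Triangle M x y z b a c) →
      ∀ x y z, K x y z → Triangle M x y z a b c := by
    intro a b c h x y z hK
    have hB' := hB _ _ _ hK
    have := (h _ _ _ (hswap _ _ _ hK)).swap_left (hB' b a).2
      (by simpa only [Crossing.turn_turn] using (hB' a b).1)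
    simpa only [Crossing.turn_turn] using this
  -- Rotation has two orbits on the eight orientations: six reached from `.up .up .up`, and the two
  -- alternating ones. An exchange of strands reaches the latter.
  have h₁ := rot .down .up .up hT
  have h₂ := rot .down .down .up h₁
  have h₃ := rot .down .down .down h₂
  have h₄ := rot .up .down .down h₃
  have h₅ := rot .up .up .down h₄
  have h₆ := swap .up .down .up h₁
  have h₇ := swap .down .up .down h₄
  cases a <;> cases b <;> cases c
  exacts [hT _ _ _ h, h₅ _ _ _ h, h₆ _ _ _ h, h₄ _ _ _ h, h₁ _ _ _ h, h₇ _ _ _ h, h₂ _ _ _ h,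
    h₃ _ _ _ h]

/-- All classical triangles are obtained from a positive braid-like one. -/
theorem triangle_classical (hM : HasIsotopy M) {o : Over}
    (hB : ∀ o a b, Bigon M (.classical o) a b)
    (hT : Triangle M (.classical o) (.classical o) (.classical o) .up .up .up)
    {o₁ o₂ o₃ : Over} (h : o₁ = o₃ → o₂ = o₁) (a b c : Dir) :
    Triangle M (.classical o₁) (.classical o₂) (.classical o₃) a b c := by
  refine triangle_of_up hM (K := fun x y z => ∃ o₁ o₂ o₃ : Over, (o₁ = o₃ → o₂ = o₁) ∧
    x = .classical o₁ ∧ y = .classical o₂ ∧ z = .classical o₃) ?_ ?_ ?_ ?_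
    ⟨o₁, o₂, o₃, h, rfl, rfl, rfl⟩ a b c
  · rintro _ _ _ ⟨o₁, o₂, o₃, -, rfl, rfl, rfl⟩ a b
    exact ⟨hB _ a b, hB _ a b⟩
  · rintro _ _ _ ⟨o₁, o₂, o₃, h, rfl, rfl, rfl⟩
    refine ⟨_, _, _, ?_, rfl, rfl, rfl⟩
    cases o₁ <;> cases o₂ <;> cases o₃ <;> simp [Over.flip] at h ⊢
  · rintro _ _ _ ⟨o₁, o₂, o₃, h, rfl, rfl, rfl⟩
    refine ⟨_, _, _, ?_, rfl, rfl, rfl⟩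
    cases o₁ <;> cases o₂ <;> cases o₃ <;> simp [Over.flip] at h ⊢
  · have hl : ∀ {o₁ o₂ o₃ : Over},
        Triangle M (.classical o₁) (.classical o₂) (.classical o₃) .up .up .up →
        Triangle M (.classical o₁.flip) (.classical o₃) (.classical o₂) .up .up .up :=
      fun h => h.swap_left (hB _ _ _) (hB _ _ _)
    have hr : ∀ {o₁ o₂ o₃ : Over},
        Triangle M (.classical o₁) (.classical o₂) (.classical o₃) .up .up .up →
        Triangle M (.classical o₂) (.classical o₁) (.classical o₃.flip) .up .up .up :=
      fun h => h.swap_right (hB _ _ _) (hB _ _ _)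
    -- The six admissible triples are the height orders of the three strands; `hl` and `hr` act as
    -- the two adjacent transpositions, and the alternatives below run through the words for the
    -- elements of the symmetric group.
    rintro _ _ _ ⟨o₁, o₂, o₃, h, rfl, rfl, rfl⟩
    cases o <;> cases o₁ <;> cases o₂ <;> cases o₃ <;> simp at h <;>
    first
    | exact hT
    | exact hl hT
    | exact hr hT
    | exact hr (hl hT)
    | exact hl (hr hT)
    | exact hl (hr (hl hT))

/-- Up to the moves `M`, a strand may be moved across a crossing of two other strands if all
crossings on it are virtual of type `α`, once this is so for one coherently oriented triangle. -/
theorem triangle_virtual (hM : HasIsotopy M) {α : T} (hv : ∀ a b, Bigon M (.virtual α) a b)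
    (hB : ∀ a b, Bigon M x a b ∧ Bigon M x.turn a b)
    (hT : Triangle M (.virtual α) x (.virtual α) .up .down .up) (hk : k = x ∨ k = x.turn)
    (a b c : Dir) : Triangle M (.virtual α) (.virtual α) k a b c := by
  refine triangle_of_up hM (K := fun p q r => ∃ k, (k = x ∨ k = x.turn) ∧
    ((p = .virtual α ∧ q = .virtual α ∧ r = k) ∨ (p = .virtual α ∧ q = k ∧ r = .virtual α) ∨
      (p = k ∧ q = .virtual α ∧ r = .virtual α))) ?_ ?_ ?_ ?_
    ⟨k, hk, .inl ⟨rfl, rfl, rfl⟩⟩ a b c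
  · rintro _ _ _ ⟨k, hk, ⟨rfl, rfl, rfl⟩ | ⟨rfl, rfl, rfl⟩ | ⟨rfl, rfl, rfl⟩⟩ a b
    · exact ⟨hv a b, hv a b⟩
    · exact ⟨hv a b, hv a b⟩
    · rcases hk with rfl | rfl
      · exact hB a b
      · rw [Crossing.turn_turn]
        exact (hB a b).symm
  · rintro _ _ _ ⟨k, hk, ⟨rfl, rfl, rfl⟩ | ⟨rfl, rfl, rfl⟩ | ⟨rfl, rfl, rfl⟩⟩
    · exact ⟨_, hk, .inr (.inr ⟨rfl, rfl, rfl⟩)⟩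
    · refine ⟨_, ?_, .inl ⟨rfl, rfl, rfl⟩⟩
      rcases hk with rfl | rfl <;> simp [Crossing.turn_turn]
    · refine ⟨_, ?_, .inr (.inl ⟨rfl, rfl, rfl⟩)⟩
      rcases hk with rfl | rfl <;> simp [Crossing.turn_turn]
  · rintro _ _ _ ⟨k, hk, ⟨rfl, rfl, rfl⟩ | ⟨rfl, rfl, rfl⟩ | ⟨rfl, rfl, rfl⟩⟩
    · exact ⟨_, hk, .inr (.inl ⟨rfl, rfl, rfl⟩)⟩
    · exact ⟨_, hk, .inl ⟨rfl, rfl, rfl⟩⟩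
    · refine ⟨_, ?_, .inr (.inr ⟨rfl, rfl, rfl⟩)⟩
      rcases hk with rfl | rfl <;> simp [Crossing.turn_turn]
  · have h₁ : Triangle M x (.virtual α) (.virtual α) .up .up .up :=
      (hT.swap_left (hv _ _) (hv _ _)).rotate hM
    have h₂ : ∀ k, k = x ∨ k = x.turn →
        Triangle M k (.virtual α) (.virtual α) .up .up .up := by
      rintro k (rfl | rfl)
      · exact h₁
      · exact h₁.swap_left (hB _ _).1 (hB _ _).2
    have h₃ : ∀ k, k = x ∨ k = x.turn →
        Triangle M (.virtual α) k (.virtual α) .up .up .up :=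
      fun k hk => (h₂ k hk).swap_right (hv _ _) (hv _ _)
    rintro _ _ _ ⟨k, hk, ⟨rfl, rfl, rfl⟩ | ⟨rfl, rfl, rfl⟩ | ⟨rfl, rfl, rfl⟩⟩
    · exact (h₃ _ hk).swap_left (hv _ _) (hv _ _)
    · exact h₃ _ hk
    · exact h₂ _ hk

/-! ### Detour moves -/

theorem pass_append (α : T) (d : Dir) (s t : List Dir) :
    pass α d (s ++ t) = pass α d s ++ shift s.length (pass α d t) := by
  induction s with
  | nil => simp [pass, shift_zero]
  | cons e s ih => simp [pass, ih, shift_append, shift_shift, Nat.add_comm]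

theorem isTangle_pass (α : T) (d : Dir) (s : List Dir) :
    IsTangle (d :: s) (pass α d s) (s ++ [d]) := by
  induction s with
  | nil => exact .nil _
  | cons e s ih =>
    refine isTangle_cons_iff.2 ⟨[], s, rfl, rfl, ?_⟩
    simpa [Piece.top] using ih.context [e] []

/-- A piece moves below a tangle diagram on its left. -/
theorem Conv.interchange_right (hM : HasIsotopy M) (h : IsTangle s w t) (p : Piece T) :
    Conv M (s ++ p.bottom) (t ++ p.top) (w ++ [⟨t.length, p⟩]) (⟨s.length, p⟩ :: w) := by
  induction h with
  | nil => exact .refl _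
  | cons l r q w t hw ih =>
    have h₁ := ih.context (S := l ++ q.bottom ++ r ++ p.bottom) (U := t ++ p.top) (l := [])
      (r := []) (below := [⟨l.length, q⟩]) (above := [])
      (isTangle_cons_iff.2 ⟨l, r ++ p.bottom, rfl, by simp, by simpa using IsTangle.nil _⟩)
      (by simpa using IsTangle.nil _)
    have h₂ := (Conv.exchange hM q p r).context (S := l ++ q.bottom ++ r ++ p.bottom)
      (U := t ++ p.top) (l := l) (r := []) (below := []) (above := w)
      (by simpa using IsTangle.nil _)
      (by simpa [shift_zero] using hw.context [] p.top)
    refine .trans (v := ⟨l.length, q⟩ :: ⟨(l ++ q.top ++ r).length, p⟩ :: w) ?_ ?_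
    · simpa [shift_zero] using h₁
    · simpa [shift, Nat.add_assoc] using h₂

/-- A piece moves below a tangle diagram on its right. -/
theorem Conv.interchange_left (hM : HasIsotopy M) (h : IsTangle s w t) (p : Piece T) :
    Conv M (p.bottom ++ s) (p.top ++ t) (shift p.bottom.length w ++ [⟨0, p⟩])
      (⟨0, p⟩ :: shift p.top.length w) := by
  induction h with
  | nil => exact .refl _
  | cons l r q w t hw ih =>
    have h₁ := ih.context (S := p.bottom ++ (l ++ q.bottom ++ r)) (U := p.top ++ t) (l := [])
      (r := []) (below := [⟨p.bottom.length + l.length, q⟩]) (above := [])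
      (isTangle_cons_iff.2 ⟨p.bottom ++ l, r, by simp, by simp, by simpa using IsTangle.nil _⟩)
      (by simpa using IsTangle.nil _)
    have h₂ := (Conv.exchange hM p q l).context (S := p.bottom ++ (l ++ q.bottom ++ r))
      (U := p.top ++ t) (l := []) (r := r) (below := []) (above := shift p.top.length w)
      (by simpa using IsTangle.nil _)
      (by simpa [shift_zero] using hw.context p.top [])
    refine .trans (v := ⟨p.bottom.length + l.length, q⟩ :: ⟨0, p⟩ :: shift p.top.length w) ?_ ?_
    · simpa [shift_zero, shift_cons] using h₁
    · simpa [shift_zero, shift_cons, shift_nil] using h₂.symm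

/-- A virtual strand moves across a piece. -/
theorem Conv.pass_piece (hM : HasIsotopy M) {α : T} (hB : ∀ a b, Bigon M (.virtual α) a b)
    (hT : ∀ x a b c, Triangle M (.virtual α) (.virtual α) x a b c) (d : Dir) (p : Piece T) :
    Conv M (d :: p.bottom) (p.top ++ [d]) (pass α d p.bottom ++ [⟨0, p⟩])
      (⟨1, p⟩ :: pass α d p.top) := by
  rcases p with e | e | ⟨x, a, b⟩
  · refine Conv.symm ?_
    -- Sliding the extremum through one of the two crossings puts both on the same leg, where they
    -- form a bigon.
    have h := hB e.rev d
    cases e <;> cases d <;>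
    exact .trans (.rwOf 0 0 (.cupSlide hM) rfl rfl ⟨rfl, rfl⟩) (.rw 1 1 h rfl rfl)
  · have h := hB d e
    cases e <;> cases d <;>
    exact .trans (.rwOf 1 0 (.capSlide' hM) rfl rfl ⟨rfl, rfl⟩) (.rw 0 0 h rfl rfl)
  · exact hT x d a b

/-- A virtual strand moves across a tangle diagram. -/
theorem Conv.slide (hM : HasIsotopy M) {α : T} (hB : ∀ a b, Bigon M (.virtual α) a b)
    (hT : ∀ x a b c, Triangle M (.virtual α) (.virtual α) x a b c) (d : Dir)
    (h : IsTangle s w t) :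
    Conv M (d :: s) (t ++ [d]) (pass α d s ++ w) (shift 1 w ++ pass α d t) := by
  induction h with
  | nil s => simpa [shift] using Conv.refl (M := M) (pass α d s)
  | cons l r p w t hw ih =>
    have hup : IsTangle (d :: (l ++ p.bottom ++ r)) [⟨1 + l.length, p⟩]
        (d :: (l ++ p.top ++ r)) :=
      isTangle_cons_iff.2 ⟨d :: l, r, by simp [Nat.add_comm], by simp, .nil _⟩
    -- The lowest piece is brought below the crossings with `r`, then the virtual strand passes it
    -- (`h₂`), then it goes below the crossings with `l` (`h₃`); induction treats the rest (`h₄`).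
    have h₁ := (Conv.interchange_left hM (isTangle_pass α d r) p).context
      (S := d :: (l ++ p.bottom ++ r)) (U := t ++ [d]) (l := l) (r := [])
      (below := pass α d (l ++ p.bottom)) (above := w)
      (by simpa [shift_zero] using (isTangle_pass α d (l ++ p.bottom)).context [] r)
      (by simpa [shift_zero] using hw.context [] [d])
    have hr : IsTangle (l ++ p.top ++ d :: r) (shift (l.length + p.top.length) (pass α d r) ++ w)
        (t ++ [d]) :=
      .append (by simpa [shift_zero] using (isTangle_pass α d r).context (l ++ p.top) [])
        (by simpa [shift_zero] using hw.context [] [d])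
    have h₂ := (Conv.pass_piece hM hB hT d p).context
      (S := d :: (l ++ p.bottom ++ r)) (U := t ++ [d]) (l := l) (r := r)
      (below := pass α d l) (above := shift (l.length + p.top.length) (pass α d r) ++ w)
      (by simpa [shift_zero] using (isTangle_pass α d l).context [] (p.bottom ++ r))
      (by simpa using hr)
    have h₃ := (Conv.interchange_right hM (isTangle_pass α d l) p).context
      (S := d :: (l ++ p.bottom ++ r)) (U := t ++ [d]) (l := []) (r := r)
      (below := []) (above := shift l.length (pass α d p.top) ++
        (shift (l.length + p.top.length) (pass α d r) ++ w))
      (by simpa using IsTangle.nil _)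
      (by simpa using ((isTangle_pass α d p.top).context l r).append (by simpa using hr))
    have h₄ := ih.context (S := d :: (l ++ p.bottom ++ r)) (U := t ++ [d]) (l := []) (r := [])
      (below := [⟨1 + l.length, p⟩]) (above := [])
      (by simpa using hup) (by simpa using IsTangle.nil _)
    simp only [pass_append, shift_append, shift_shift, shift_cons, shift_nil, shift_zero,
      List.append_assoc, List.nil_append, List.cons_append, List.append_nil, Nat.add_zero,
      List.length_append, List.length_cons, List.length_nil, Nat.zero_add] at h₁ h₂ h₃ h₄ ⊢
    rw [Nat.add_comm 1 l.length] at h₄ ⊢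
    exact h₁.trans (h₂.trans (h₃.trans h₄))

/-- The detour move across a minimum gives the virtual bigons. -/
theorem bigon_of_slide (hM : HasIsotopy M) {α : T} {f : Dir}
    (h : Conv M [d] [f.rev, f, d] [⟨0, .cup f.rev⟩]
      [⟨1, .cup f.rev⟩, ⟨0, .cross (.virtual α) d f.rev⟩, ⟨1, .cross (.virtual α) d f⟩]) :
    Bigon M (.virtual α) f d := by
  -- With a zigzag inserted in the strand `f`, the bigon becomes a detour of `d` around a minimum of
  -- that zigzag. The word of `e₁` undoes this detour; `e₂` straightens the zigzag first.
  have e₁ : Conv M [f, d] [f, d]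
      (⟨1, .cup f.rev⟩ :: (shift 2 (bigon (.virtual α) f d) ++ [⟨0, .cap f⟩])) [] := by
    cases f <;> cases d <;>
    exact .trans (.rwOf 0 1 (.cupSlide' hM) rfl rfl ⟨rfl, rfl⟩) <|
      .trans (.rw 0 1 h.symm rfl rfl) <|
      .rwOf 0 0 (.zigzagRight hM) rfl rfl rfl
  have e₂ : Conv M [f, d] [f, d]
      (⟨1, .cup f.rev⟩ :: (shift 2 (bigon (.virtual α) f d) ++ [⟨0, .cap f⟩]))
      (bigon (.virtual α) f d) := by
    cases f <;> cases d <;>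
    exact .trans (.swapLeft hM 2 rfl rfl rfl) <|
      .trans (.swapLeft hM 1 rfl rfl rfl) <|
      .rwOf 0 0 (.zigzagRight hM) rfl rfl rfl
  exact e₂.symm.trans e₁

end MultiVirtual

/-! ### The main theorem -/

open MultiVirtual in
/-- The choices `o₁` and `o₂` cover the mirror-image conventions for the classical moves. -/
theorem theorem2p3 {T : Type*} (o₁ o₂ : MultiVirtual.Over) (D D' : MultiVirtual.Diagram T) :
    MultiVirtual.Equivalent D D' ↔
      MultiVirtual.Related
        (fun s t u v => MultiVirtual.Isotopy s t u v ∨ MultiVirtual.OrientedMove o₁ o₂ s t u v)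
        D D' := by
  rw [Equivalent, related_iff_conv, related_iff_conv]
  constructor
  · refine Conv.of_le fun s t u v h hu hv => ?_
    set M : Moves T := fun s t u v => Isotopy s t u v ∨ OrientedMove o₁ o₂ s t u v
    have hM : HasIsotopy M := fun _ _ _ _ h => .inl h
    have mk : ∀ {s t u v}, OrientedMove o₁ o₂ s t u v → run s u = some t → run s v = some t →
        Conv M s t u v :=
      fun h hu hv => .of_move (.inr h) (.of_run hu) (.of_run hv)
    obtain ⟨hcB, hcR, hcL, hcT⟩ := generate (x := .classical o₁) hM (mk .Ω1a rfl rfl)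
      (mk .Ω1b rfl rfl)
      (by
        have h : Bigon M (.classical o₂) .up .up := mk .Ω2a rfl rfl
        -- `o₂` is either `o₁` or its flip, that is, the crossing `x` or `x.turn` of `generate`.
        cases o₁ <;> cases o₂ <;> first | exact .inl h | exact .inr h)
      (mk .Ω3a rfl rfl)
    have hvR : ∀ α : T, LoopRight M (.virtual α) .up := fun α => mk (.v1a α) rfl rfl
    have hvL : ∀ α : T, LoopLeft M (.virtual α) .up := fun α => mk (.v1b α) rfl rfl
    have hvB : ∀ (α : T) (a b : Dir), Bigon M (.virtual α) a b := fun α a b =>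
      ((generate (x := .virtual α) hM (hvR α) (hvL α) (.inl (mk (.v2a α) rfl rfl))
        (mk (.mv3a α α) rfl rfl)).1 a b).1
    have hcB' : ∀ o a b, Bigon M (.classical o) a b := fun o a b => by
      cases o <;> cases o₁ <;> first | exact (hcB a b).1 | exact (hcB a b).2
    have hvT : ∀ (α : T) (x : Crossing T) (a b c : Dir),
        Triangle M (.virtual α) (.virtual α) x a b c := by
      rintro α (o | β) a b c
      -- Only the negative crossing is given; the positive one is its quarter turn.
      · refine triangle_virtual (x := .classical .backslash) hM (hvB α)
          (fun a b => ⟨hcB' _ a b, hcB' _ a b⟩) (mk (.cv3a α) rfl rfl) ?_ a b c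
        cases o
        exacts [.inr rfl, .inl rfl]
      · exact triangle_virtual (x := .virtual β) hM (hvB α)
          (fun a b => ⟨hvB _ a b, hvB _ a b⟩) (mk (.mv3a α β) rfl rfl) (.inl rfl) a b c
    rcases h with h | h | h
    · exact .of_move (.inl h) hu hv
    · cases h with
      | oneRight o d =>
        have hR : LoopRight M (.classical o) .up := by
          cases o <;> cases o₁ <;> first | exact hcR | exact mk .Ω1a rfl rfl
        have hL : LoopLeft M (.classical o) .up := by
          cases o <;> cases o₁ <;> first | exact hcL | exact mk .Ω1b rfl rfl
        cases d
        -- A half turn takes a left loop on an upward strand to a right loop on a downward one.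
        exacts [hR, hL.rotate hM]
      | oneLeft o d =>
        have hR : LoopRight M (.classical o) .up := by
          cases o <;> cases o₁ <;> first | exact hcR | exact mk .Ω1a rfl rfl
        have hL : LoopLeft M (.classical o) .up := by
          cases o <;> cases o₁ <;> first | exact hcL | exact mk .Ω1b rfl rfl
        cases d
        exacts [hL, hR.rotate hM]
      | two o a b => exact hcB' o a b
      | three _ _ _ a b c h => exact triangle_classical hM hcB' hcT h a b c
    · cases h with
      | slide α d s t w h => exact .slide hM (hvB α) (hvT α) d h
      | loopRight α d =>
        cases d
        exacts [hvR α, (hvL α).rotate hM]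
      | loopLeft α d =>
        cases d
        exacts [hvL α, (hvR α).rotate hM]
  · refine Conv.of_le fun s t u v h hu hv => ?_
    set M : Moves T := fun s t u v => Isotopy s t u v ∨ Reidemeister s t u v ∨ Detour s t u v
    have hM : HasIsotopy M := fun _ _ _ _ h => .inl h
    have hvB : ∀ (α : T) (a b : Dir), Bigon M (.virtual α) a b := fun α a b => by
      refine bigon_of_slide hM ?_
      have h := Detour.slide α b [] [a.rev, a.rev.rev] [⟨0, .cup a.rev⟩]
        (by cases a <;> exact .of_run rfl)
      rw [Dir.rev_rev] at h
      exact .of_move (.inr (.inr h)) (by cases a <;> cases b <;> exact .of_run rfl)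
        (by cases a <;> cases b <;> exact .of_run rfl)
    have hvT : ∀ (α : T) (x : Crossing T),
        Triangle M (.virtual α) x (.virtual α) .up .down .up := by
      intro α x
      -- A downward strand detoured across a single crossing of two upward strands; exchanging the
      -- first two strands makes the triangle coherent.
      have h : Triangle M (.virtual α) (.virtual α) x .down .up .up :=
        .of_move (.inr (.inr (.slide α .down [.up, .up] [.up, .up] [⟨0, .cross x .up .up⟩]
          (.of_run rfl)))) (.of_run rfl) (.of_run rfl)
      exact h.swap_left (hvB _ _ _) (hvB _ _ _)
    rcases h with h | h
    · exact .of_move (.inl h) hu hv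
    · cases h with
      | Ω1a => exact .of_move (.inr (.inl (.oneRight _ _))) hu hv
      | Ω1b => exact .of_move (.inr (.inl (.oneLeft _ _))) hu hv
      | Ω2a => exact .of_move (.inr (.inl (.two _ _ _))) hu hv
      | Ω3a => exact .of_move (.inr (.inl (.three _ _ _ _ _ _ fun _ => rfl))) hu hv
      | v1a α => exact .of_move (.inr (.inr (.loopRight _ _))) hu hv
      | v1b α => exact .of_move (.inr (.inr (.loopLeft _ _))) hu hv
      | v2a α => exact hvB _ _ _
      | cv3a α => exact hvT _ _
      | mv3a α β => exact hvT _ _
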